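/- **Notation.** Let $\mathbb R_+=(0,\infty)$, let $C_0^\infty(\mathbb R_+)$ be the space of complex-valued smooth functions with compact support in $\mathbb R_+$ with its usual (LF) topology, and let $C_0^\infty(\mathbb R_+)'$ be the space of continuous antilinear functionals $h$ on it; write $\langle h,F\rangle$ for the value of $h$ at $F$ (linear in $h$, antilinear in $F$). Let $\mathcal Y$ be the space of entire functions $\varphi$ for which there are constants $C_n$ ($n=0,1,2,\dots$), $r_+<0$ and $r_-\in\mathbb R$ with $$|\varphi(\lambda)|\le C_n(1+|\lambda|)^{-n}e^{r_\pm|\operatorname{Re}\lambda|},\qquad \pm\operatorname{Re}\lambda\ge 0,\quad n=0,1,2,\dots .$$ By definition $\varphi_k\to0$ in $\mathcal Y$ if all $\varphi_k$ satisfy these bounds with the same constants $r_\pm$, $C_n$ and $\varphi_k\to 0$ uniformly on compact subsets of $\mathbb C$. Let $\mathcal Y'$ be the space of antilinear functionals $\sigma$ on $\mathcal Y$ such that $\langle\sigma,\varphi_k\rangle\to0$ whenever $\varphi_k\to0$ in $\mathcal Y$. For $\varphi\in\mathcal Y$ put $\varphi^*(\lambda)=\overline{\varphi(\bar\lambda)}$.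 Let $(\mathsf Lf)(\lambda)=\int_0^\infty e^{-t\lambda}f(t)\,dt$ be the Laplace transform, which maps $C_0^\infty(\mathbb R_+)$ into $\mathcal Y$, and let $\mathsf L^*:\mathcal Y'\to C_0^\infty(\mathbb R_+)'$ be its adjoint, $\langle\mathsf L^*\sigma,F\rangle=\langle\sigma,\mathsf LF\rangle$. For $f,g\in C_0^\infty(\mathbb R_+)$ let $(f\star g)(t)=\int_0^t f(s)g(t-s)\,ds$. **Theorem.** Let $h\in C_0^\infty(\mathbb R_+)'$. Then there is exactly one $\sigma\in\mathcal Y'$ with $\mathsf L^*\sigma=h$, that is, $\sigma=(\mathsf L^*)^{-1}h$ (the sigma-function of $h$) is well defined; and $$\langle h,\bar f_1\star f_2\rangle=\langle\sigma,(\mathsf Lf_1)^*\,\mathsf Lf_2\rangle\qquad\text{for all } f_1,f_2\in C_0^\infty(\mathbb R_+).$$ -/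

import Mathlib

open scoped Distributions ContDiff Topology ComplexConjugate Pointwise
open MeasureTheory Set Filter

namespace HankelSigma

/-! ### Test functions and distributions on the half-line -/

/-- The open half-line `ℝ₊ = (0, ∞)`. -/
def halfLine : TopologicalSpace.Opens ℝ := ⟨Ioi 0, isOpen_Ioi⟩

/-- `C₀^∞(ℝ₊)`: complex-valued smooth functions with compact support in `(0, ∞)`, with the
canonical LF topology. The elements are functions on `ℝ`, extended by zero. -/
abbrev TestFn : Type := 𝓓(halfLine, ℂ)

/-- The dual space `C₀^∞(ℝ₊)'`: continuous *antilinear* functionals. The duality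
`⟨h, F⟩` (linear in `h`, antilinear in `F`) is `h F`. -/
abbrev Distr : Type := TestFn →SL[starRingEnd ℂ] ℂ

theorem TestFn.smooth (f : TestFn) : ContDiff ℝ ∞ (f : ℝ → ℂ) := f.contDiff

theorem TestFn.eq_zero_of_nonpos (f : TestFn) {t : ℝ} (ht : t ≤ 0) : f t = 0 := by
  by_contra hne
  have h1 : t ∈ (halfLine : Set ℝ) := f.tsupport_subset (subset_tsupport _ hne)
  exact absurd (show (0 : ℝ) < t from h1) (not_lt.mpr ht)

/-- The complex conjugate `f̄` of a test function. -/
noncomputable def conjFn (f : TestFn) : TestFn where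
  toFun t := conj (f t)
  contDiff' := Complex.conjCLE.contDiff.comp f.contDiff
  hasCompactSupport' := f.hasCompactSupport.comp_left (g := fun z : ℂ => conj z) (by simp)
  tsupport_subset' := (closure_mono (fun t ht => by
    simp only [Function.mem_support] at ht ⊢
    intro h0
    exact ht (by simp [h0]))).trans f.tsupport_subset

theorem laplaceConv_eq_convolution (f g : TestFn) :
    (fun t : ℝ => ∫ s in (0 : ℝ)..t, f s * g (t - s)) =
      MeasureTheory.convolution (f : ℝ → ℂ) g (ContinuousLinearMap.mul ℝ ℂ) volume := by
  funext t
  rw [MeasureTheory.convolution_def]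
  simp only [ContinuousLinearMap.mul_apply']
  rcases le_total 0 t with ht | ht
  · rw [intervalIntegral.integral_of_le ht]
    refine setIntegral_eq_integral_of_forall_compl_eq_zero fun s hs => ?_
    rcases le_or_gt s 0 with h0 | h0
    · simp [f.eq_zero_of_nonpos h0]
    · have : t < s := by
        by_contra hc
        exact hs ⟨h0, not_lt.mp hc⟩
      simp [g.eq_zero_of_nonpos (sub_nonpos.mpr this.le)]
  · have h1 : ∀ s : ℝ, f s * g (t - s) = 0 := fun s => by
      rcases le_or_gt s 0 with h0 | h0
      · simp [f.eq_zero_of_nonpos h0]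
      · simp [g.eq_zero_of_nonpos (show t - s ≤ 0 by linarith)]
    simp [h1]

/-- The Laplace convolution `(f ⋆ g)(t) = ∫₀ᵗ f(s) g(t - s) ds` of test functions. -/
noncomputable def laplaceConv (f g : TestFn) : TestFn where
  toFun t := ∫ s in (0 : ℝ)..t, f s * g (t - s)
  contDiff' := by
    rw [laplaceConv_eq_convolution]
    exact g.hasCompactSupport.contDiff_convolution_right _
      (f.continuous.locallyIntegrable) g.contDiff
  hasCompactSupport' := by
    rw [laplaceConv_eq_convolution]
    exact f.hasCompactSupport.convolution _ g.hasCompactSupport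
  tsupport_subset' := by
    rw [laplaceConv_eq_convolution]
    have hc : IsCompact (tsupport (f : ℝ → ℂ) + tsupport (g : ℝ → ℂ)) :=
      f.hasCompactSupport.isCompact.add g.hasCompactSupport.isCompact
    refine (closure_minimal ((MeasureTheory.support_convolution_subset _).trans
      (Set.add_subset_add (subset_tsupport _) (subset_tsupport _))) hc.isClosed).trans ?_
    rintro _ ⟨x, hx, y, hy, rfl⟩
    have hx' : (0 : ℝ) < x := f.tsupport_subset hx
    have hy' : (0 : ℝ) < y := g.tsupport_subset hy
    exact add_pos hx' hy'

/-! ### The space `𝒴` of entire functions and its dual -/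

/-- The bounds `|φ(λ)| ≤ C_n (1 + |λ|)^{-n} e^{r_± |Re λ|}` for `± Re λ ≥ 0` and all `n`. -/
def YBound (C : ℕ → ℝ) (rp rm : ℝ) (φ : ℂ → ℂ) : Prop :=
  ∀ (n : ℕ) (z : ℂ),
    (0 ≤ z.re → ‖φ z‖ ≤ C n / (1 + ‖z‖) ^ n * Real.exp (rp * |z.re|)) ∧
    (z.re ≤ 0 → ‖φ z‖ ≤ C n / (1 + ‖z‖) ^ n * Real.exp (rm * |z.re|))

/-- The space `𝒴` of entire functions satisfying the bounds `YBound` for some constants `C_n`,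
some `r₊ < 0` and some real `r₋`. -/
def Y : Submodule ℂ (ℂ → ℂ) where
  carrier := {φ | Differentiable ℂ φ ∧
    ∃ (C : ℕ → ℝ) (rp rm : ℝ), rp < 0 ∧ YBound C rp rm φ}
  zero_mem' := by
    refine ⟨differentiable_const 0, fun _ => 0, -1, 0, by norm_num, fun n z => ?_⟩
    simp
  add_mem' := by
    rintro φ ψ ⟨hφ, C, p, m, hp, hC⟩ ⟨hψ, D, q, l, hq, hD⟩
    refine ⟨hφ.add hψ, fun n => |C n| + |D n|, max p q, max m l, max_lt hp hq, fun n z => ?_⟩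
    have key : ∀ r s : ℝ, ‖φ z‖ ≤ C n / (1 + ‖z‖) ^ n * Real.exp (r * |z.re|) →
        ‖ψ z‖ ≤ D n / (1 + ‖z‖) ^ n * Real.exp (s * |z.re|) →
        ‖(φ + ψ) z‖ ≤ (|C n| + |D n|) / (1 + ‖z‖) ^ n * Real.exp (max r s * |z.re|) := by
      intro r s h1 h2
      have h3 : C n / (1 + ‖z‖) ^ n * Real.exp (r * |z.re|) ≤
          |C n| / (1 + ‖z‖) ^ n * Real.exp (max r s * |z.re|) := by
        gcongr
        · exact le_abs_self _
        · exact le_max_left _ _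
      have h4 : D n / (1 + ‖z‖) ^ n * Real.exp (s * |z.re|) ≤
          |D n| / (1 + ‖z‖) ^ n * Real.exp (max r s * |z.re|) := by
        gcongr
        · exact le_abs_self _
        · exact le_max_right _ _
      calc ‖(φ + ψ) z‖ ≤ ‖φ z‖ + ‖ψ z‖ := norm_add_le _ _
        _ ≤ _ := add_le_add (h1.trans h3) (h2.trans h4)
        _ = _ := by ring
    exact ⟨fun hz => key _ _ ((hC n z).1 hz) ((hD n z).1 hz),
      fun hz => key _ _ ((hC n z).2 hz) ((hD n z).2 hz)⟩
  smul_mem' := by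
    rintro c φ ⟨hφ, C, p, m, hp, hC⟩
    refine ⟨hφ.const_smul c, fun n => ‖c‖ * C n, p, m, hp, fun n z => ?_⟩
    have key : ∀ r : ℝ, ‖φ z‖ ≤ C n / (1 + ‖z‖) ^ n * Real.exp (r * |z.re|) →
        ‖(c • φ) z‖ ≤ ‖c‖ * C n / (1 + ‖z‖) ^ n * Real.exp (r * |z.re|) := by
      intro r h1
      calc ‖(c • φ) z‖ = ‖c‖ * ‖φ z‖ := by simp
        _ ≤ ‖c‖ * (C n / (1 + ‖z‖) ^ n * Real.exp (r * |z.re|)) := by gcongr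
        _ = _ := by ring
    exact ⟨fun hz => key _ ((hC n z).1 hz), fun hz => key _ ((hC n z).2 hz)⟩

/-- Convergence `φ_k → 0` in `𝒴`: all `φ_k` satisfy the bounds with the same constants, and
`φ_k → 0` uniformly on compact subsets of `ℂ`. -/
def YTendstoZero (φ : ℕ → Y) : Prop :=
  (∃ (C : ℕ → ℝ) (rp rm : ℝ), rp < 0 ∧ ∀ k, YBound C rp rm (φ k : ℂ → ℂ)) ∧
  ∀ K : Set ℂ, IsCompact K → TendstoUniformlyOn (fun k => (φ k : ℂ → ℂ)) 0 atTop K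

/-- The dual space `𝒴'`: antilinear functionals on `𝒴` that are continuous for the convergence
of sequences in `𝒴`. The duality `⟨σ, φ⟩` is `σ φ`. -/
def YDual : Submodule ℂ (Y →ₛₗ[starRingEnd ℂ] ℂ) where
  carrier := {σ | ∀ φ : ℕ → Y, YTendstoZero φ → Tendsto (fun k => σ (φ k)) atTop (𝓝 0)}
  zero_mem' := fun φ _ => by simp
  add_mem' := fun {σ τ} hσ hτ φ hφ => by simpa using (hσ φ hφ).add (hτ φ hφ)
  smul_mem' := fun c σ hσ φ hφ => by simpa using (hσ φ hφ).const_mul c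

/-- The conjugation `φ*(λ) = conj (φ (conj λ))` on `𝒴`. -/
noncomputable def yStar (φ : Y) : Y :=
  ⟨fun z => conj ((φ : ℂ → ℂ) (conj z)), by
    obtain ⟨hφ, C, p, m, hp, hC⟩ := φ.2
    refine ⟨fun z => ?_, C, p, m, hp, fun n z => ?_⟩
    · have h := (hφ (conj z)).conj_conj
      rw [Complex.conj_conj] at h
      exact h
    simpa using hC n (conj z)⟩

/-- The pointwise product on `𝒴`. -/
noncomputable def yMul (φ ψ : Y) : Y :=
  ⟨fun z => (φ : ℂ → ℂ) z * (ψ : ℂ → ℂ) z, by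
    obtain ⟨hφ, C, p, m, hp, hC⟩ := φ.2
    obtain ⟨hψ, D, q, l, hq, hD⟩ := ψ.2
    refine ⟨hφ.mul hψ, fun n => C n * D 0, p + q, m + l, add_neg hp hq, fun n z => ?_⟩
    have key : ∀ r s : ℝ, ‖(φ : ℂ → ℂ) z‖ ≤ C n / (1 + ‖z‖) ^ n * Real.exp (r * |z.re|) →
        ‖(ψ : ℂ → ℂ) z‖ ≤ D 0 / (1 + ‖z‖) ^ 0 * Real.exp (s * |z.re|) →
        ‖(φ : ℂ → ℂ) z * (ψ : ℂ → ℂ) z‖ ≤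
          C n * D 0 / (1 + ‖z‖) ^ n * Real.exp ((r + s) * |z.re|) := by
      intro r s h1 h2
      rw [norm_mul, add_mul, Real.exp_add]
      refine (mul_le_mul h1 h2 (norm_nonneg _) ((norm_nonneg _).trans h1)).trans (le_of_eq ?_)
      simp only [pow_zero, div_one]
      ring
    exact ⟨fun hz => key _ _ ((hC n z).1 hz) ((hD 0 z).1 hz),
      fun hz => key _ _ ((hC n z).2 hz) ((hD 0 z).2 hz)⟩⟩

/-! ### The Laplace transform -/

/-- The Laplace transform `(L f)(λ) = ∫₀^∞ e^{-tλ} f(t) dt` as a function of `λ ∈ ℂ`. -/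
noncomputable def laplaceFun (f : ℝ → ℂ) (z : ℂ) : ℂ :=
  ∫ t in Ioi (0 : ℝ), Complex.exp (-((t : ℂ) * z)) * f t

theorem laplaceFun_eq (f : TestFn) (z : ℂ) :
    laplaceFun f z = ∫ t : ℝ, Complex.exp (-((t : ℂ) * z)) * f t :=
  setIntegral_eq_integral_of_forall_compl_eq_zero fun t ht => by
    simp [f.eq_zero_of_nonpos (not_lt.mp ht)]

theorem integrable_exp_mul {g : ℝ → ℂ} (hg : Continuous g) (hs : HasCompactSupport g) (z : ℂ) :
    Integrable (fun t : ℝ => Complex.exp (-((t : ℂ) * z)) * g t) :=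
  Continuous.integrable_of_hasCompactSupport (by fun_prop) hs.mul_left

theorem differentiable_laplaceFun (f : TestFn) : Differentiable ℂ (laplaceFun f) := by
  intro z₀
  have he : laplaceFun f = fun z => ∫ t : ℝ, Complex.exp (-((t : ℂ) * z)) * f t :=
    funext (laplaceFun_eq f)
  rw [he]
  have hc : Continuous (f : ℝ → ℂ) := f.continuous
  refine (hasDerivAt_integral_of_dominated_loc_of_deriv_le
    (F := fun z (t : ℝ) => Complex.exp (-((t : ℂ) * z)) * f t)
    (F' := fun z (t : ℝ) => Complex.exp (-((t : ℂ) * z)) * (-(t : ℂ)) * f t)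
    (bound := fun t : ℝ => Real.exp (|t| * (‖z₀‖ + 1)) * |t| * ‖f t‖)
    (Metric.ball_mem_nhds z₀ one_pos) ?_ ?_ ?_ ?_ ?_ ?_).2.differentiableAt
  · exact Eventually.of_forall fun z =>
      (integrable_exp_mul hc f.hasCompactSupport z).aestronglyMeasurable
  · exact integrable_exp_mul hc f.hasCompactSupport z₀
  · exact Continuous.aestronglyMeasurable (by fun_prop)
  · refine Eventually.of_forall fun t z hz => ?_
    rw [norm_mul, norm_mul, norm_neg, Complex.norm_real, Real.norm_eq_abs]
    gcongr
    rw [Complex.norm_exp]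
    gcongr
    refine (Complex.re_le_norm _).trans ?_
    rw [norm_neg, norm_mul, Complex.norm_real, Real.norm_eq_abs]
    gcongr
    have h1 : ‖z - z₀‖ < 1 := by simpa [dist_eq_norm] using hz
    have h2 : ‖z‖ ≤ ‖z₀‖ + ‖z - z₀‖ := by simpa using norm_add_le z₀ (z - z₀)
    linarith
  · exact Continuous.integrable_of_hasCompactSupport (by fun_prop) f.hasCompactSupport.norm.mul_left
  · refine Eventually.of_forall fun t z _ => ?_
    have h1 : HasDerivAt (fun z : ℂ => -((t : ℂ) * z)) (-(t : ℂ)) z := by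
      simpa using! ((hasDerivAt_id z).const_mul (t : ℂ)).neg
    exact h1.cexp.mul_const _

theorem mul_integral_exp {g : ℝ → ℂ} (hg : ContDiff ℝ ∞ g) (hs : HasCompactSupport g) (z : ℂ) :
    z * ∫ t : ℝ, Complex.exp (-((t : ℂ) * z)) * g t =
      ∫ t : ℝ, Complex.exp (-((t : ℂ) * z)) * deriv g t := by
  have hd : Continuous (deriv g) := hg.continuous_deriv (by simp)
  have hexp : ∀ t : ℝ, HasDerivAt (fun t : ℝ => Complex.exp (-((t : ℂ) * z)))
      (Complex.exp (-((t : ℂ) * z)) * (-z)) t := fun t => by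
    have h1 : HasDerivAt (fun t : ℝ => -((t : ℂ) * z)) (-z) t := by
      simpa using! ((Complex.ofRealCLM.hasDerivAt (x := t)).mul_const z).neg
    exact h1.cexp
  have h := integral_mul_deriv_eq_deriv_mul_of_integrable (A := ℂ)
    (u := fun t : ℝ => Complex.exp (-((t : ℂ) * z)))
    (u' := fun t : ℝ => Complex.exp (-((t : ℂ) * z)) * (-z)) (v := g) (v' := deriv g)
    (fun t _ => hexp t)
    (fun t _ => (hg.differentiable (by simp) t).hasDerivAt)
    (integrable_exp_mul hd hs.deriv z)
    (by
      have := (integrable_exp_mul hg.continuous hs z).const_mul (-z)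
      refine this.congr (Eventually.of_forall fun t => ?_)
      simp only [Pi.mul_apply]; ring)
    (integrable_exp_mul hg.continuous hs z)
  rw [h, ← integral_const_mul, ← integral_neg]
  congr 1
  funext t
  ring

theorem pow_mul_integral_exp (n : ℕ) : ∀ {g : ℝ → ℂ}, ContDiff ℝ ∞ g → HasCompactSupport g →
    ∀ z : ℂ, z ^ n * ∫ t : ℝ, Complex.exp (-((t : ℂ) * z)) * g t =
      ∫ t : ℝ, Complex.exp (-((t : ℂ) * z)) * iteratedDeriv n g t := by
  induction n with
  | zero => intro g _ _ z; simp
  | succ n ih =>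
    intro g hg hs z
    rw [pow_succ, mul_assoc, mul_integral_exp hg hs z, iteratedDeriv_succ']
    exact ih (contDiff_infty_iff_deriv.mp hg).2 hs.deriv z

theorem norm_pow_mul_laplaceFun_le (f : TestFn) {a b : ℝ} (hab : a ≤ b)
    (hsupp : tsupport (f : ℝ → ℂ) ⊆ Icc a b) {n : ℕ} {M : ℝ}
    (hM : ∀ t, ‖iteratedDeriv n f t‖ ≤ M) {z : ℂ} {E : ℝ} (hE : 0 ≤ E)
    (hexp : ∀ t ∈ Icc a b, Real.exp (-(t * z.re)) ≤ E) :
    ‖z‖ ^ n * ‖laplaceFun f z‖ ≤ E * M * (b - a) := by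
  rw [laplaceFun_eq, ← norm_pow, ← norm_mul,
    pow_mul_integral_exp n f.smooth f.hasCompactSupport z]
  have h0 : ∀ t, t ∉ Icc a b → Complex.exp (-((t : ℂ) * z)) * iteratedDeriv n f t = 0 := by
    intro t ht
    have h1 : iteratedDeriv n f t = 0 := by
      rw [← norm_eq_zero, ← norm_iteratedFDeriv_eq_norm_iteratedDeriv, norm_eq_zero]
      by_contra hne
      exact ht (hsupp (support_iteratedFDeriv_subset n hne))
    simp [h1]
  rw [← setIntegral_eq_integral_of_forall_compl_eq_zero h0]
  have h2 := norm_setIntegral_le_of_norm_le_const (μ := (volume : Measure ℝ)) (s := Icc a b)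
    (f := fun t : ℝ => Complex.exp (-((t : ℂ) * z)) * iteratedDeriv n f t) (C := E * M)
    (by simp) (fun t ht => by
      rw [norm_mul, Complex.norm_exp]
      refine mul_le_mul ?_ (hM t) (norm_nonneg _) hE
      simpa using hexp t ht)
  simpa [hab] using h2

theorem yBound_laplaceFun (f : TestFn) {a b : ℝ} (hab : a ≤ b)
    (hsupp : tsupport (f : ℝ → ℂ) ⊆ Icc a b) {M : ℕ → ℝ}
    (hM : ∀ n t, ‖iteratedDeriv n f t‖ ≤ M n) :
    YBound (fun n => 2 ^ n * ((M 0 + M n) * (b - a))) (-a) b (laplaceFun f) := by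
  intro n z
  have key : ∀ E : ℝ, 0 ≤ E → (∀ t ∈ Icc a b, Real.exp (-(t * z.re)) ≤ E) →
      ‖laplaceFun f z‖ ≤ 2 ^ n * ((M 0 + M n) * (b - a)) / (1 + ‖z‖) ^ n * E := by
    intro E hE hexp
    have h0 := norm_pow_mul_laplaceFun_le f hab hsupp (hM 0) hE hexp
    have hn := norm_pow_mul_laplaceFun_le f hab hsupp (hM n) hE hexp
    rw [pow_zero, one_mul] at h0
    have hpow : (1 + ‖z‖) ^ n ≤ 2 ^ n * (1 + ‖z‖ ^ n) := by
      rcases le_total ‖z‖ 1 with h1 | h1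
      · calc (1 + ‖z‖) ^ n ≤ 2 ^ n := by gcongr; linarith
          _ = 2 ^ n * 1 := by ring
          _ ≤ _ := by gcongr; simp
      · calc (1 + ‖z‖) ^ n ≤ (2 * ‖z‖) ^ n := by gcongr; linarith
          _ = 2 ^ n * ‖z‖ ^ n := mul_pow _ _ _
          _ ≤ _ := by gcongr; simp
    have hpos : 0 < (1 + ‖z‖) ^ n := by positivity
    rw [div_mul_eq_mul_div, le_div_iff₀ hpos]
    calc ‖laplaceFun f z‖ * (1 + ‖z‖) ^ n
        ≤ ‖laplaceFun f z‖ * (2 ^ n * (1 + ‖z‖ ^ n)) := by gcongr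
      _ = 2 ^ n * (‖laplaceFun f z‖ + ‖z‖ ^ n * ‖laplaceFun f z‖) := by ring
      _ ≤ 2 ^ n * (E * M 0 * (b - a) + E * M n * (b - a)) := by gcongr
      _ = _ := by ring
  constructor
  · intro hz
    refine key _ (Real.exp_pos _).le fun t ht => Real.exp_le_exp.mpr ?_
    rw [abs_of_nonneg hz]
    nlinarith [ht.1]
  · intro hz
    refine key _ (Real.exp_pos _).le fun t ht => Real.exp_le_exp.mpr ?_
    rw [abs_of_nonpos hz]
    nlinarith [ht.2]

theorem exists_Icc_of_isCompact {K : Set ℝ} (hK : IsCompact K) (hK' : K ⊆ Ioi 0) :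
    ∃ a b : ℝ, 0 < a ∧ a ≤ b ∧ K ⊆ Icc a b := by
  rcases K.eq_empty_or_nonempty with rfl | hne
  · exact ⟨1, 1, one_pos, le_rfl, by simp⟩
  · obtain ⟨a, ha⟩ := hK.exists_isLeast hne
    obtain ⟨b, hb⟩ := hK.exists_isGreatest hne
    exact ⟨a, b, hK' ha.1, ha.2 hb.1, fun t ht => ⟨ha.2 ht, hb.2 ht⟩⟩

theorem exists_bound_iteratedDeriv (f : TestFn) :
    ∃ M : ℕ → ℝ, ∀ n t, ‖iteratedDeriv n f t‖ ≤ M n := by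
  have h : ∀ n : ℕ, ∃ M : ℝ, ∀ t, ‖iteratedDeriv n f t‖ ≤ M := by
    intro n
    obtain ⟨M, hM⟩ := (f.smooth.continuous_iteratedFDeriv (m := n)
      (by exact_mod_cast le_top)).bounded_above_of_compact_support
      (f.hasCompactSupport.iteratedFDeriv n)
    exact ⟨M, fun t => by rw [← norm_iteratedFDeriv_eq_norm_iteratedDeriv]; exact hM t⟩
  exact ⟨fun n => (h n).choose, fun n => (h n).choose_spec⟩

theorem laplaceFun_mem (f : TestFn) : laplaceFun f ∈ Y := by
  obtain ⟨a, b, ha, hab, hsupp⟩ := exists_Icc_of_isCompact f.hasCompactSupport.isCompact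
    f.tsupport_subset
  obtain ⟨M, hM⟩ := exists_bound_iteratedDeriv f
  exact ⟨differentiable_laplaceFun f, _, -a, b, by linarith, yBound_laplaceFun f hab hsupp hM⟩

/-- The Laplace transform `L : C₀^∞(ℝ₊) → 𝒴`. -/
noncomputable def laplace : TestFn →ₗ[ℂ] Y where
  toFun f := ⟨laplaceFun f, laplaceFun_mem f⟩
  map_add' f g := by
    ext z
    simp only [Submodule.coe_add, Pi.add_apply, laplaceFun_eq]
    rw [← integral_add (integrable_exp_mul f.continuous f.hasCompactSupport z)
      (integrable_exp_mul g.continuous g.hasCompactSupport z)]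
    congr 1
    funext t
    simp [mul_add]
  map_smul' c f := by
    ext z
    simp only [Submodule.coe_smul, Pi.smul_apply, laplaceFun_eq, RingHom.id_apply, smul_eq_mul]
    rw [← integral_const_mul]
    congr 1
    funext t
    simp only [smul_apply, smul_eq_mul]
    ring

/-- `L` is sequentially continuous at `0` on functions supported in a fixed compact set. -/
theorem yTendstoZero_laplace {K : TopologicalSpace.Compacts ℝ} (hK : (K : Set ℝ) ⊆ halfLine)
    {f : ℕ → 𝓓_{K}(ℝ, ℂ)} (hf : Tendsto f atTop (𝓝 0)) :
    YTendstoZero fun k => laplace (TestFunction.ofSupportedIn hK (f k)) := by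
  obtain ⟨a, b, ha, hab, hsupp⟩ := exists_Icc_of_isCompact K.isCompact hK
  have hs : ∀ n, Tendsto (fun k => N[ℝ; ℂ]_{K, n} (f k)) atTop (𝓝 0) := fun n => by
    have h1 := ((ContDiffMapSupportedIn.withSeminorms ℝ ℝ ℂ ⊤ K).continuous_seminorm n).tendsto 0
    rw [map_zero] at h1
    exact h1.comp hf
  have hsup : ∀ k, tsupport (TestFunction.ofSupportedIn hK (f k) : ℝ → ℂ) ⊆ Icc a b := fun k =>
    (f k).tsupport_subset.trans hsupp
  have hle : ∀ k n t, ‖iteratedDeriv n (TestFunction.ofSupportedIn hK (f k) : ℝ → ℂ) t‖ ≤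
      N[ℝ; ℂ]_{K, n} (f k) := fun k n t => by
    rw [← norm_iteratedFDeriv_eq_norm_iteratedDeriv]
    exact ContDiffMapSupportedIn.norm_iteratedFDeriv_apply_le_seminorm_top ℝ
  constructor
  · have hb : ∀ n, ∃ M, ∀ k, N[ℝ; ℂ]_{K, n} (f k) ≤ M := fun n => by
      obtain ⟨M, hM⟩ := (hs n).bddAbove_range
      exact ⟨M, fun k => hM ⟨k, rfl⟩⟩
    choose M hM using hb
    exact ⟨_, -a, b, by linarith, fun k =>
      yBound_laplaceFun _ hab (hsup k) fun n t => (hle k n t).trans (hM n k)⟩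
  · intro S hS
    obtain ⟨R, hR⟩ := hS.isBounded.exists_norm_le
    rw [Metric.tendstoUniformlyOn_iff]
    intro ε hε
    have h1 : Tendsto (fun k => Real.exp (b * R) * N[ℝ; ℂ]_{K, 0} (f k) * (b - a)) atTop (𝓝 0) := by
      simpa using ((hs 0).const_mul (Real.exp (b * R))).mul_const (b - a)
    filter_upwards [h1.eventually (gt_mem_nhds hε)] with k hk z hz
    have h2 := norm_pow_mul_laplaceFun_le (TestFunction.ofSupportedIn hK (f k)) hab (hsup k)
      (n := 0) (hle k 0) (z := z) (Real.exp_pos (b * R)).le (fun t ht => by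
        refine Real.exp_le_exp.mpr ?_
        have h3 : -z.re ≤ R := (neg_le_abs _).trans ((Complex.abs_re_le_norm z).trans (hR z hz))
        have h4 : 0 ≤ R := (norm_nonneg z).trans (hR z hz)
        nlinarith [ht.1, ht.2])
    rw [pow_zero, one_mul] at h2
    rw [Pi.zero_apply, dist_zero_left]
    exact h2.trans_lt hk

theorem continuous_comp_laplace (σ : YDual) :
    Continuous fun F : TestFn => (σ : Y →ₛₗ[starRingEnd ℂ] ℂ) (laplace F) := by
  let T : TestFn →ₗ[ℝ] ℂ :=
    { toFun := fun F => (σ : Y →ₛₗ[starRingEnd ℂ] ℂ) (laplace F)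
      map_add' := fun F G => by simp
      map_smul' := fun c F => by
        have h : (c • F : TestFn) = (c : ℂ) • F := by ext t; simp
        rw [h, map_smul, LinearMap.map_smulₛₗ]
        simp }
  change Continuous T
  rw [TestFunction.continuous_iff_continuous_comp]
  intro K hK
  have : FirstCountableTopology 𝓓_{K}(ℝ, ℂ) :=
    (ContDiffMapSupportedIn.withSeminorms ℝ ℝ ℂ ⊤ K).firstCountableTopology
  let S : 𝓓_{K}(ℝ, ℂ) →+ ℂ :=
    T.toAddMonoidHom.comp (TestFunction.ofSupportedInCLM ℝ hK).toLinearMap.toAddMonoidHom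
  change Continuous S
  refine continuous_of_continuousAt_zero S ?_
  rw [ContinuousAt, map_zero, tendsto_iff_seq_tendsto]
  intro f hf
  exact σ.2 _ (yTendstoZero_laplace hK hf)

/-- The adjoint `L* : 𝒴' → C₀^∞(ℝ₊)'`, `⟨L* σ, F⟩ = ⟨σ, L F⟩`. -/
noncomputable def laplaceAdjoint : YDual →ₗ[ℂ] Distr where
  toFun σ :=
    { toLinearMap := (σ : Y →ₛₗ[starRingEnd ℂ] ℂ).comp laplace
      cont := continuous_comp_laplace σ }
  map_add' σ τ := by ext F; rfl
  map_smul' c σ := by ext F; rfl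

end HankelSigma

/-!
The theorem holds because the Laplace transform `L` is a bijection of `C₀^∞(ℝ₊)` onto `𝒴` whose
inverse is continuous for the convergence of sequences in `𝒴`. Then `⟨σ, φ⟩ = ⟨h, L⁻¹ φ⟩` defines
an element of `𝒴'` with `L* σ = h`, surjectivity of `L` makes it the only one, and the identity for
`⟨h, f̄₁ ⋆ f₂⟩` reduces to `L(f̄₁ ⋆ f₂) = (L f₁)* · L f₂` (`laplace_conjFn`,
`laplace_laplaceConv`).

On the imaginary axis `L` is a Fourier transform, so the candidate for `L⁻¹ φ` is the inversion
integral `laplaceInv φ` of `φ` restricted to that axis. The rapid decay of `φ` makes it smooth. By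
Cauchy's theorem the integral may be moved to any line `Re λ = x`; there the exponential bounds
defining `𝒴` and `x → ± ∞` force its support into `[-r₊, r₋]`, a compact subset of `(0, ∞)` as
`r₊ < 0` (`YBound.support_laplaceInv_subset`). Fourier inversion gives both `L⁻¹ L f = f` and
`L L⁻¹ φ = φ` on the imaginary axis, hence everywhere, since both sides are entire.

If `φ_k → 0` in `𝒴`, the functions `L⁻¹ φ_k` are supported in one compact set, and each of their
derivatives is bounded by `∫ |λ|ⁿ |φ_k(λ)| |dλ|` over the imaginary axis (up to a constant),
which tends to zero by dominated convergence (`tendsto_of_yTendstoZero_laplace`).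
-/

namespace HankelSigma

open scoped FourierTransform Real
open Complex (I)

/-! ### Functions on the imaginary axis and the inversion formula -/

/-- The restriction `v ↦ φ(-2πiv)` of `φ` to the imaginary axis. With this normalisation the
restriction of a Laplace transform is Mathlib's inverse Fourier transform. -/
noncomputable def axisRestr (φ : ℂ → ℂ) (v : ℝ) : ℂ := φ (-2 * π * I * v)

/-- The inverse Laplace transform `t ↦ (2π)⁻¹ ∫ e^{iyt} φ(iy) dy`, with the contour on the
imaginary axis. It is written as the Fourier transform of `v ↦ φ(-2πiv)`, which absorbs the
factor `(2π)⁻¹`. -/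
noncomputable def laplaceInv (φ : ℂ → ℂ) : ℝ → ℂ := 𝓕 (axisRestr φ)

theorem axisRestr_laplaceFun (f : TestFn) : axisRestr (laplaceFun f) = 𝓕⁻ (f : ℝ → ℂ) := by
  funext v
  rw [axisRestr, laplaceFun_eq, Real.fourierInv_eq']
  congr 1
  funext t
  rw [smul_eq_mul]
  congr 2
  simp only [RCLike.inner_apply, conj_trivial]
  push_cast
  ring

theorem TestFn.integrable (f : TestFn) : Integrable (f : ℝ → ℂ) :=
  f.continuous.integrable_of_hasCompactSupport f.hasCompactSupport

theorem norm_axis (v : ℝ) : ‖(-2 * π * I * v : ℂ)‖ = 2 * π * |v| := by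
  simp [abs_of_pos Real.pi_pos]

/-- Two of the powers of `1 + |λ|` in `YBound` pay for integrability along the imaginary axis. -/
theorem YBound.norm_pow_mul_axisRestr_le {C : ℕ → ℝ} {rp rm : ℝ} {φ : ℂ → ℂ}
    (hφ : YBound C rp rm φ) (n : ℕ) (v : ℝ) :
    ‖(-2 * π * I * v : ℂ) ^ n * axisRestr φ v‖ ≤ |C (n + 2)| * (1 + v ^ 2)⁻¹ := by
  have h := (hφ (n + 2) (-2 * π * I * v)).1 (by simp)
  have hw := norm_axis v
  have hre : (-2 * π * I * v : ℂ).re = 0 := by simp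
  rw [hre, abs_zero, mul_zero, Real.exp_zero, mul_one] at h
  rw [norm_mul, norm_pow, axisRestr]
  set w := ‖(-2 * π * I * v : ℂ)‖
  have hw0 : 0 ≤ w := norm_nonneg _
  have hle : 1 + v ^ 2 ≤ (1 + w) ^ 2 := by
    have h1 : |v| ≤ w := by
      rw [hw]; nlinarith [abs_nonneg v, Real.pi_gt_three]
    have h2 := sq_abs v
    nlinarith [abs_nonneg v]
  calc w ^ n * ‖φ (-2 * π * I * v)‖ ≤ (1 + w) ^ n * (|C (n + 2)| / (1 + w) ^ (n + 2)) := by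
        gcongr
        · linarith
        · exact h.trans (by gcongr; exact le_abs_self _)
    _ = |C (n + 2)| * ((1 + w) ^ 2)⁻¹ := by field_simp; ring
    _ ≤ _ := by gcongr

theorem continuous_axisRestr {φ : ℂ → ℂ} (hd : Differentiable ℂ φ) :
    Continuous (axisRestr φ) :=
  hd.continuous.comp (by fun_prop)

theorem YBound.integrable_pow_mul_axisRestr {C : ℕ → ℝ} {rp rm : ℝ} {φ : ℂ → ℂ}
    (hd : Differentiable ℂ φ) (hφ : YBound C rp rm φ) (n : ℕ) :
    Integrable fun v : ℝ => (-2 * π * I * v : ℂ) ^ n * axisRestr φ v :=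
  (integrable_inv_one_add_sq.const_mul _).mono'
    ((by fun_prop : Continuous fun v : ℝ => (-2 * π * I * v : ℂ) ^ n).mul
      (continuous_axisRestr hd)).aestronglyMeasurable
    (Eventually.of_forall (hφ.norm_pow_mul_axisRestr_le n))

theorem YBound.integrable_pow_smul_axisRestr {C : ℕ → ℝ} {rp rm : ℝ} {φ : ℂ → ℂ}
    (hd : Differentiable ℂ φ) (hφ : YBound C rp rm φ) (n : ℕ) :
    Integrable fun v : ℝ => v ^ n • axisRestr φ v := by
  refine ((hφ.integrable_pow_mul_axisRestr hd n).const_mul ((-2 * π * I : ℂ) ^ n)⁻¹).congr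
    (Eventually.of_forall fun v => ?_)
  have hne : (-2 * π * I : ℂ) ^ n ≠ 0 := pow_ne_zero _ (by simp [Real.pi_ne_zero])
  change _ * ((-2 * π * I * v : ℂ) ^ n * axisRestr φ v) = v ^ n • axisRestr φ v
  rw [Complex.real_smul, Complex.ofReal_pow, mul_pow _ (v : ℂ), mul_assoc (_ ^ n),
    inv_mul_cancel_left₀ hne]

theorem YBound.integrable_axisRestr {C : ℕ → ℝ} {rp rm : ℝ} {φ : ℂ → ℂ}
    (hd : Differentiable ℂ φ) (hφ : YBound C rp rm φ) : Integrable (axisRestr φ) := by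
  simpa using hφ.integrable_pow_mul_axisRestr hd 0

theorem YBound.contDiff_laplaceInv {C : ℕ → ℝ} {rp rm : ℝ} {φ : ℂ → ℂ}
    (hd : Differentiable ℂ φ) (hφ : YBound C rp rm φ) : ContDiff ℝ ∞ (laplaceInv φ) :=
  Real.contDiff_fourier fun n _ => by
    simpa [norm_smul] using (hφ.integrable_pow_smul_axisRestr hd n).norm

/-- The right-hand side does not depend on `t`, so this controls the `n`-th seminorm of
`laplaceInv φ` by a weighted `L¹` norm of `φ` on the imaginary axis. -/
theorem YBound.norm_iteratedDeriv_laplaceInv_le {C : ℕ → ℝ} {rp rm : ℝ} {φ : ℂ → ℂ}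
    (hd : Differentiable ℂ φ) (hφ : YBound C rp rm φ) (n : ℕ) (t : ℝ) :
    ‖iteratedDeriv n (laplaceInv φ) t‖ ≤
      ∫ v : ℝ, ‖(-2 * π * I * v : ℂ) ^ n * axisRestr φ v‖ := by
  rw [laplaceInv, Real.iteratedDeriv_fourier (N := ⊤)
    (fun m _ => hφ.integrable_pow_smul_axisRestr hd m) le_top]
  rw [Real.fourier_eq']
  refine (norm_integral_le_integral_norm _).trans (le_of_eq ?_)
  congr 1
  funext v
  rw [norm_smul, Complex.norm_exp_ofReal_mul_I, one_mul, smul_eq_mul]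

/-! ### Shifting the contour and the support of the inverse transform -/

/-- Cauchy's theorem on the strip between `Re z = 0` and `Re z = x`, for an entire function
decaying quadratically along the strip. -/
theorem integral_verticalLine_eq {F : ℂ → ℂ} (hF : Differentiable ℂ F) {x M : ℝ}
    (hM : ∀ z : ℂ, |z.re| ≤ |x| → ‖F z‖ ≤ M * (1 + z.im ^ 2)⁻¹) :
    ∫ y : ℝ, F (x + y * I) = ∫ y : ℝ, F (y * I) := by
  have hint : ∀ s : ℝ, |s| ≤ |x| → Integrable fun y : ℝ => F (s + y * I) := fun s hs => by
    refine (integrable_inv_one_add_sq.const_mul M).mono'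
      (hF.continuous.comp (by fun_prop)).aestronglyMeasurable (Eventually.of_forall fun y => ?_)
    simpa using hM (s + y * I) (by simpa using hs)
  have hlim : ∀ s : ℝ, |s| ≤ |x| → Tendsto (fun T : ℝ => ∫ y in (-T)..T, F (s + y * I)) atTop
      (𝓝 (∫ y : ℝ, F (s + y * I))) := fun s hs =>
    intervalIntegral_tendsto_integral (hint s hs) tendsto_neg_atTop_atBot tendsto_id
  have hdecay : Tendsto (fun T : ℝ => M * (1 + T ^ 2)⁻¹ * |x - 0|) atTop (𝓝 0) := by
    have h1 : Tendsto (fun T : ℝ => (1 + T ^ 2)⁻¹) atTop (𝓝 0) :=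
      tendsto_inv_atTop_zero.comp
        (tendsto_atTop_add_const_left _ _ (tendsto_pow_atTop two_ne_zero))
    simpa using (h1.const_mul M).mul_const |x - 0|
  -- The horizontal sides, at heights `ε T` with `ε = ± 1`, vanish as `T → ∞`.
  have hside : ∀ ε : ℝ, ε ^ 2 = 1 →
      Tendsto (fun T : ℝ => ∫ s in (0 : ℝ)..x, F (s + (ε * T : ℝ) * I)) atTop (𝓝 0) :=
    fun ε hε => by
      refine squeeze_zero_norm (fun T => ?_) hdecay
      refine intervalIntegral.norm_integral_le_of_norm_le_const fun s hs => ?_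
      have hs' : |s| ≤ |x| := by
        have := abs_sub_left_of_mem_uIcc (uIoc_subset_uIcc hs)
        simpa using this
      have := hM (s + (ε * T : ℝ) * I) (by simpa using hs')
      simpa [mul_pow, hε] using this
  have hrect : ∀ T : ℝ, (∫ s in (0 : ℝ)..x, F (s + (-1 * T : ℝ) * I)) -
      (∫ s in (0 : ℝ)..x, F (s + (1 * T : ℝ) * I)) + I * (∫ y in (-T)..T, F (x + y * I)) -
      I * (∫ y in (-T)..T, F ((0 : ℝ) + y * I)) = 0 := fun T => by
    have := Complex.integral_boundary_rect_eq_zero_of_differentiableOn F (-(T * I)) (x + T * I)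
      hF.differentiableOn
    simpa using this
  have h0 := ((((hside (-1) (by norm_num)).sub (hside 1 (by norm_num))).add
    ((hlim x le_rfl).const_mul I)).sub ((hlim 0 (by simp)).const_mul I))
  simp only [hrect] at h0
  have h1 := tendsto_nhds_unique tendsto_const_nhds h0
  simp only [sub_zero, zero_add, Complex.ofReal_zero] at h1
  exact mul_left_cancel₀ Complex.I_ne_zero (sub_eq_zero.mp h1.symm)

/-- On the line `Re z = x` the integrand `e^{2πzt} φ(2πz)` of the inversion integral is
`O(e^{2πx(t + r₊)})` for `x ≥ 0` and `O(e^{2πx(t - r₋)})` for `x ≤ 0`, with an integrable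
majorant in `Im z` that does not depend on `x`. -/
theorem YBound.norm_shift_le {C : ℕ → ℝ} {rp rm : ℝ} {φ : ℂ → ℂ}
    (hφ : YBound C rp rm φ) (t : ℝ) (z : ℂ) :
    (0 ≤ z.re → ‖Complex.exp (2 * π * z * t) * φ (2 * π * z)‖ ≤
      |C 2| * Real.exp (2 * π * z.re * (t + rp)) * (1 + z.im ^ 2)⁻¹) ∧
    (z.re ≤ 0 → ‖Complex.exp (2 * π * z * t) * φ (2 * π * z)‖ ≤
      |C 2| * Real.exp (2 * π * z.re * (t - rm)) * (1 + z.im ^ 2)⁻¹) := by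
  have hre : (2 * π * z : ℂ).re = 2 * π * z.re := by simp
  have hn : ‖(2 * π * z : ℂ)‖ = 2 * π * ‖z‖ := by simp [abs_of_pos Real.pi_pos]
  have he : ‖Complex.exp (2 * π * z * t)‖ = Real.exp (2 * π * z.re * t) := by
    rw [Complex.norm_exp]; simp
  have hle : 1 + z.im ^ 2 ≤ (1 + ‖(2 * π * z : ℂ)‖) ^ 2 := by
    have h1 : |z.im| ≤ ‖(2 * π * z : ℂ)‖ := by
      rw [hn]; nlinarith [norm_nonneg z, Real.pi_gt_three, Complex.abs_im_le_norm z]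
    nlinarith [abs_nonneg z.im, sq_abs z.im]
  have key : ∀ r s : ℝ, ‖φ (2 * π * z)‖ ≤ C 2 / (1 + ‖(2 * π * z : ℂ)‖) ^ 2 * Real.exp r →
      2 * π * z.re * t + r = s → ‖Complex.exp (2 * π * z * t) * φ (2 * π * z)‖ ≤
      |C 2| * Real.exp s * (1 + z.im ^ 2)⁻¹ := by
    rintro r s h rfl
    rw [norm_mul, he, Real.exp_add]
    calc _ ≤ Real.exp (2 * π * z.re * t) *
          (|C 2| / (1 + z.im ^ 2) * Real.exp r) := by
          gcongr
          refine h.trans ?_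
          gcongr
          exact le_abs_self _
      _ = _ := by rw [div_eq_mul_inv]; ring
  have hpi := Real.pi_pos
  constructor
  · intro hz
    have hz' : 0 ≤ 2 * π * z.re := by positivity
    refine key _ _ ((hφ 2 (2 * π * z)).1 (hre ▸ hz')) ?_
    rw [hre, abs_of_nonneg hz']; ring
  · intro hz
    have hz' : 2 * π * z.re ≤ 0 := mul_nonpos_of_nonneg_of_nonpos (by positivity) hz
    refine key _ _ ((hφ 2 (2 * π * z)).2 (hre ▸ hz')) ?_
    rw [hre, abs_of_nonpos hz']; ring

/-- The inversion integral may be taken over any vertical line. -/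
theorem YBound.laplaceInv_eq_integral {C : ℕ → ℝ} {rp rm : ℝ} {φ : ℂ → ℂ}
    (hd : Differentiable ℂ φ) (hφ : YBound C rp rm φ) (t x : ℝ) :
    laplaceInv φ t =
      ∫ y : ℝ, Complex.exp (2 * π * (x + y * I) * t) * φ (2 * π * (x + y * I)) := by
  have hF : Differentiable ℂ fun z : ℂ => Complex.exp (2 * π * z * t) * φ (2 * π * z) :=
    (by fun_prop : Differentiable ℂ fun z : ℂ => Complex.exp (2 * π * z * t)).mul
      (hd.comp (by fun_prop))
  rw [integral_verticalLine_eq hF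
    (M := |C 2| * Real.exp (2 * π * |x| * (|t| + |rp| + |rm|))) fun z hz => ?_]
  · rw [laplaceInv, Real.fourier_eq', ← integral_neg_eq_self]
    congr 1
    funext v
    simp only [axisRestr, RCLike.inner_apply, conj_trivial, smul_eq_mul]
    push_cast
    congr 2 <;> ring
  · have hpi := Real.pi_pos
    have key : ∀ s : ℝ, |s| ≤ |t| + |rp| + |rm| →
        2 * π * z.re * s ≤ 2 * π * |x| * (|t| + |rp| + |rm|) := fun s hs => by
      rw [mul_assoc, mul_assoc (2 * π)]
      gcongr 2 * π * ?_
      calc z.re * s ≤ |z.re * s| := le_abs_self _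
        _ = |z.re| * |s| := abs_mul _ _
        _ ≤ _ := by gcongr
    rcases le_total 0 z.re with h | h
    · refine ((hφ.norm_shift_le t z).1 h).trans ?_
      gcongr |C 2| * Real.exp ?_ * _
      exact key _ ((abs_add_le _ _).trans (by linarith [abs_nonneg rm]))
    · refine ((hφ.norm_shift_le t z).2 h).trans ?_
      gcongr |C 2| * Real.exp ?_ * _
      exact key _ ((abs_sub _ _).trans (by linarith [abs_nonneg rp]))

theorem norm_integral_le_mul_pi {F : ℝ → ℂ} {c : ℝ} (h : ∀ y, ‖F y‖ ≤ c * (1 + y ^ 2)⁻¹) :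
    ‖∫ y, F y‖ ≤ c * π := by
  have := norm_integral_le_of_norm_le (integrable_inv_one_add_sq.const_mul c)
    (Eventually.of_forall h)
  rwa [integral_const_mul, integral_univ_inv_one_add_sq] at this

/-- Paley–Wiener: moving the contour to `Re z → +∞` kills the inversion integral for `t < -r₊`,
and moving it to `Re z → -∞` kills it for `t > r₋`. -/
theorem YBound.support_laplaceInv_subset {C : ℕ → ℝ} {rp rm : ℝ} {φ : ℂ → ℂ}
    (hd : Differentiable ℂ φ) (hφ : YBound C rp rm φ) :
    Function.support (laplaceInv φ) ⊆ Icc (-rp) rm := by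
  have hpi := Real.pi_pos
  have hexp : ∀ c : ℝ, c < 0 →
      Tendsto (fun x : ℝ => |C 2| * Real.exp (2 * π * x * c) * π) atTop (𝓝 0) := fun c hc => by
    have h1 : Tendsto (fun x : ℝ => 2 * π * x * c) atTop atBot :=
      (tendsto_id.const_mul_atTop (by positivity : 0 < 2 * π)).atTop_mul_const_of_neg hc
    simpa using ((Real.tendsto_exp_atBot.comp h1).const_mul |C 2|).mul_const π
  intro t ht
  rw [Function.mem_support] at ht
  by_contra hmem
  apply ht
  rw [← norm_le_zero_iff]
  rcases not_and_or.mp hmem with h | h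
  · refine ge_of_tendsto (hexp (t + rp) (by linarith)) ?_
    filter_upwards [eventually_ge_atTop 0] with x hx
    rw [hφ.laplaceInv_eq_integral hd t x]
    exact norm_integral_le_mul_pi fun y => by
      simpa using (hφ.norm_shift_le t (x + y * I)).1 (by simpa using hx)
  · refine ge_of_tendsto (hexp (rm - t) (by linarith)) ?_
    filter_upwards [eventually_ge_atTop 0] with x hx
    rw [hφ.laplaceInv_eq_integral hd t (-x)]
    have he : 2 * π * x * (rm - t) = 2 * π * (-x) * (t - rm) := by ring
    rw [he]
    exact norm_integral_le_mul_pi fun y => by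
      simpa using (hφ.norm_shift_le t ((-x : ℝ) + y * I)).2 (by simpa using hx)

/-! ### Bijectivity of the Laplace transform -/

theorem laplaceInv_laplaceFun (f : TestFn) : laplaceInv (laplaceFun f) = f := by
  obtain ⟨hd, C, rp, rm, -, hC⟩ := laplaceFun_mem f
  -- `𝓕 f` is the reflection of `𝓕⁻ f = axisRestr (laplaceFun f)`, which decays by `YBound`.
  have hint : Integrable (𝓕 (f : ℝ → ℂ)) := by
    have h := (hC.integrable_axisRestr hd).comp_neg
    rw [axisRestr_laplaceFun] at h
    simpa [Real.fourierInv_eq_fourier_neg] using h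
  rw [laplaceInv, axisRestr_laplaceFun]
  exact f.continuous.fourier_fourierInv_eq f.integrable hint

/-- Identity theorem: an entire function is determined by its values on the imaginary axis. -/
theorem eq_of_axisRestr_eq {φ ψ : ℂ → ℂ} (hφ : Differentiable ℂ φ) (hψ : Differentiable ℂ ψ)
    (h : axisRestr φ = axisRestr ψ) : φ = ψ := by
  refine AnalyticOnNhd.eq_of_frequently_eq (z₀ := 0) (fun z _ => hφ.analyticAt z)
    (fun z _ => hψ.analyticAt z) ?_
  have hlim : Tendsto (fun v : ℝ => (-2 * π * I * v : ℂ)) (𝓝[≠] 0) (𝓝[≠] 0) := by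
    refine tendsto_nhdsWithin_iff.mpr ⟨?_, ?_⟩
    · have hc : Continuous fun v : ℝ => (-2 * π * I * v : ℂ) := by fun_prop
      simpa using (hc.tendsto 0).mono_left nhdsWithin_le_nhds
    · filter_upwards [self_mem_nhdsWithin] with v hv
      have hv' : v ≠ 0 := hv
      simp [hv', Real.pi_ne_zero]
  exact hlim.frequently (Frequently.of_forall fun v => congrFun h v)

theorem laplace_injective : Function.Injective laplace := fun f g hfg => by
  have h : laplaceFun f = laplaceFun g := congrArg Subtype.val hfg
  exact DFunLike.coe_injective (by rw [← laplaceInv_laplaceFun f, h, laplaceInv_laplaceFun g])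

theorem laplace_surjective : Function.Surjective laplace := fun φ => by
  obtain ⟨hd, C, rp, rm, hrp, hC⟩ := φ.2
  have hsupp : tsupport (laplaceInv φ) ⊆ Icc (-rp) rm :=
    closure_minimal (hC.support_laplaceInv_subset hd) isClosed_Icc
  let f : TestFn :=
    { toFun := laplaceInv φ
      contDiff' := hC.contDiff_laplaceInv hd
      hasCompactSupport' := HasCompactSupport.of_support_subset_isCompact isCompact_Icc
        (hC.support_laplaceInv_subset hd)
      tsupport_subset' := hsupp.trans fun t ht => (neg_pos.mpr hrp).trans_le ht.1 }
  have hf : (f : ℝ → ℂ) = 𝓕 (axisRestr φ) := rfl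
  refine ⟨f, Subtype.ext (eq_of_axisRestr_eq (differentiable_laplaceFun f) hd ?_)⟩
  refine (axisRestr_laplaceFun f).trans ?_
  rw [hf]
  exact (continuous_axisRestr hd).fourierInv_fourier_eq (hC.integrable_axisRestr hd)
    (hf ▸ f.integrable)

/-! ### Continuity of the inverse and the sigma-function -/

theorem YTendstoZero.tendsto_integral_axisRestr {φ : ℕ → Y} (hφ : YTendstoZero φ) (n : ℕ) :
    Tendsto (fun k => ∫ v : ℝ, ‖(-2 * π * I * v : ℂ) ^ n * axisRestr (φ k) v‖) atTop (𝓝 0) := by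
  obtain ⟨⟨C, rp, rm, -, hC⟩, hunif⟩ := hφ
  rw [← integral_zero ℝ ℝ]
  refine tendsto_integral_of_dominated_convergence (fun v => |C (n + 2)| * (1 + v ^ 2)⁻¹)
    (fun k => ((hC k).integrable_pow_mul_axisRestr (φ k).2.1 n).norm.aestronglyMeasurable)
    (integrable_inv_one_add_sq.const_mul _)
    (fun k => Eventually.of_forall fun v => ?_) (Eventually.of_forall fun v => ?_)
  · rw [norm_norm]
    exact (hC k).norm_pow_mul_axisRestr_le n v
  · have h := (hunif {-2 * π * I * v} isCompact_singleton).tendsto_at (mem_singleton _)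
    simpa [axisRestr] using (h.const_mul ((-2 * π * I * v : ℂ) ^ n)).norm

/-- Sequential continuity of the inverse Laplace transform. The uniform constants `r₊`, `r₋` in
`YTendstoZero` keep all supports in the fixed compact set `[-r₊, r₋]`, so the convergence takes
place in a single space `𝓓_K`. -/
theorem tendsto_of_yTendstoZero_laplace {f : ℕ → TestFn}
    (hf : YTendstoZero fun k => laplace (f k)) : Tendsto f atTop (𝓝 0) := by
  obtain ⟨C, rp, rm, hrp, hC⟩ := hf.1
  have hinv : ∀ k, laplaceInv (laplace (f k) : ℂ → ℂ) = f k := fun k => laplaceInv_laplaceFun _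
  -- If `rm < -rp` then `K` is empty and all `f k` vanish.
  let K : TopologicalSpace.Compacts ℝ := ⟨Icc (-rp) rm, isCompact_Icc⟩
  have hK : (K : Set ℝ) ⊆ halfLine := fun t ht => (neg_pos.mpr hrp).trans_le ht.1
  let g : ℕ → 𝓓_{K}(ℝ, ℂ) := fun k => .of_support_subset (f k).contDiff
    (hinv k ▸ (hC k).support_laplaceInv_subset (laplace (f k)).2.1)
  have hg : Tendsto g atTop (𝓝 0) := by
    rw [(ContDiffMapSupportedIn.withSeminorms ℝ ℝ ℂ ⊤ K).tendsto_nhds]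
    intro n ε hε
    filter_upwards [(hf.tendsto_integral_axisRestr n).eventually (gt_mem_nhds hε)] with k hk
    rw [sub_zero]
    refine lt_of_le_of_lt ?_ hk
    rw [ContDiffMapSupportedIn.seminorm_top_le_iff ℝ (integral_nonneg fun _ => norm_nonneg _)]
    intro t _
    rw [norm_iteratedFDeriv_eq_norm_iteratedDeriv]
    have := (hC k).norm_iteratedDeriv_laplaceInv_le (laplace (f k)).2.1 n t
    rwa [hinv k] at this
  have h := ((TestFunction.continuous_ofSupportedIn hK).tendsto
    (0 : 𝓓_{K}(ℝ, ℂ))).comp hg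
  have h0 : TestFunction.ofSupportedIn hK (0 : 𝓓_{K}(ℝ, ℂ)) = (0 : TestFn) := rfl
  rw [h0] at h
  exact h

/-- The Laplace transform as a linear isomorphism of `C₀^∞(ℝ₊)` onto `𝒴`. -/
noncomputable def laplaceEquiv : TestFn ≃ₗ[ℂ] Y :=
  LinearEquiv.ofBijective laplace ⟨laplace_injective, laplace_surjective⟩

theorem laplace_laplaceEquiv_symm (φ : Y) : laplace (laplaceEquiv.symm φ) = φ :=
  laplaceEquiv.apply_symm_apply φ

/-- The sigma-function `σ = (L*)⁻¹ h` of a distribution `h`, i.e. `⟨σ, φ⟩ = ⟨h, L⁻¹ φ⟩`. -/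
noncomputable def sigmaFunction (h : Distr) : YDual :=
  ⟨h.toLinearMap.comp laplaceEquiv.symm.toLinearMap, fun φ hφ => by
    have h1 : Tendsto (fun k => laplaceEquiv.symm (φ k)) atTop (𝓝 0) :=
      tendsto_of_yTendstoZero_laplace (by simpa only [laplace_laplaceEquiv_symm] using hφ)
    have h2 := (h.continuous.tendsto 0).comp h1
    rw [map_zero] at h2
    exact h2⟩

/-! ### Existence and uniqueness for the adjoint, and the convolution identity -/

theorem laplaceAdjoint_sigmaFunction (h : Distr) : laplaceAdjoint (sigmaFunction h) = h := by
  ext F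
  exact congrArg h (laplaceEquiv.symm_apply_apply F)

/-- A consequence of the surjectivity of the Laplace transform onto `𝒴`. -/
theorem laplaceAdjoint_injective : Function.Injective laplaceAdjoint := fun σ τ hστ => by
  refine Subtype.ext (LinearMap.ext fun φ => ?_)
  obtain ⟨F, rfl⟩ := laplace_surjective φ
  exact DFunLike.congr_fun hστ F

theorem laplace_conjFn (f : TestFn) : laplace (conjFn f) = yStar (laplace f) := by
  refine Subtype.ext (funext fun z => ?_)
  change laplaceFun (conjFn f) z = conj (laplaceFun f (conj z))
  rw [laplaceFun, laplaceFun, ← integral_conj]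
  congr 1
  funext t
  rw [map_mul, ← Complex.exp_conj]
  simp only [map_neg, map_mul, Complex.conj_ofReal, Complex.conj_conj]
  rfl

theorem laplace_laplaceConv (f g : TestFn) :
    laplace (laplaceConv f g) = yMul (laplace f) (laplace g) := by
  refine Subtype.ext (funext fun z => ?_)
  change laplaceFun (laplaceConv f g) z = laplaceFun f z * laplaceFun g z
  have hconv : (laplaceConv f g : ℝ → ℂ) =
      MeasureTheory.convolution (f : ℝ → ℂ) g (ContinuousLinearMap.mul ℝ ℂ) volume :=
    laplaceConv_eq_convolution f g
  have h := integral_convolution (ContinuousLinearMap.mul ℝ ℂ)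
    (integrable_exp_mul f.continuous f.hasCompactSupport z)
    (integrable_exp_mul g.continuous g.hasCompactSupport z)
  rw [ContinuousLinearMap.mul_apply'] at h
  rw [laplaceFun_eq, laplaceFun_eq, laplaceFun_eq, ← h, hconv]
  congr 1
  funext t
  rw [convolution_def, convolution_def, ← integral_const_mul]
  congr 1
  funext s
  simp only [ContinuousLinearMap.mul_apply']
  have he : Complex.exp (-((t : ℂ) * z)) =
      Complex.exp (-((s : ℂ) * z)) * Complex.exp (-(((t - s : ℝ) : ℂ) * z)) := by
    rw [← Complex.exp_add]
    congr 1
    push_cast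
    ring
  rw [he]
  ring

end HankelSigma

theorem theorem2p3 (h : HankelSigma.Distr) :
    (∃! σ : HankelSigma.YDual, HankelSigma.laplaceAdjoint σ = h) ∧
    ∀ σ : HankelSigma.YDual, HankelSigma.laplaceAdjoint σ = h →
      ∀ f₁ f₂ : HankelSigma.TestFn,
        h (HankelSigma.laplaceConv (HankelSigma.conjFn f₁) f₂) =
          σ.1 (HankelSigma.yMul
            (HankelSigma.yStar (HankelSigma.laplace f₁)) (HankelSigma.laplace f₂)) := by
  refine ⟨⟨HankelSigma.sigmaFunction h, HankelSigma.laplaceAdjoint_sigmaFunction h,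
    fun τ hτ => HankelSigma.laplaceAdjoint_injective
      (hτ.trans (HankelSigma.laplaceAdjoint_sigmaFunction h).symm)⟩, ?_⟩
  rintro σ rfl f₁ f₂
  rw [← HankelSigma.laplace_conjFn, ← HankelSigma.laplace_laplaceConv]
  rfl
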